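/- Let $\mathbb D$ be the open unit disc and $\mathbb T$ the unit circle of $\mathbb C$, let $p\ge 1$ be a real number, and put $v_p(z)=(1-|z|^2)^p$ for $z\in\mathbb D$. For a complex Banach space $F$, let $H^\infty_{v_p}(\mathbb D,F)$ be the space of all holomorphic mappings $f:\mathbb D\to F$ with $\|f\|_{v_p}:=\sup_{z\in\mathbb D}v_p(z)\|f(z)\|<\infty$, normed by $\|\cdot\|_{v_p}$, and let $H^\infty_{v_p}(\mathbb D)=H^\infty_{v_p}(\mathbb D,\mathbb C)$. Let $G^\infty_{v_p}(\mathbb D)$ be the space of all linear functionals on $H^\infty_{v_p}(\mathbb D)$ whose restrictions to the closed unit ball are continuous for the compact-open topology, with the norm of the dual space $H^\infty_{v_p}(\mathbb D)^*$. For $z\in\mathbb D$ let $\delta_z\in G^\infty_{v_p}(\mathbb D)$ be the evaluation $\delta_z(f)=f(z)$, and let $\mathbb T\mathrm{At}=\{\lambda v_p(z)\delta_z:\lambda\in\mathbb T,\ z\in\mathbb D\}$. (1) For every complex Banach space $F$, $H^\infty_{v_p}(\mathbb D,F)$ has the $WH^\infty$-Bishop--Phelps--Bollobás property: for every $0<\varepsilon<1$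 there is $0<\eta<\varepsilon$ such that, for every $f\in H^\infty_{v_p}(\mathbb D,F)$ with $\|f\|_{v_p}=1$, every $\lambda\in\mathbb T$ and every $z\in\mathbb D$ with $v_p(z)\|f(z)\|>1-\eta$, there exist $f_0\in H^\infty_{v_p}(\mathbb D,F)$ with $\|f_0\|_{v_p}=1$, $\lambda_0\in\mathbb T$ and $z_0\in\mathbb D$ such that $v_p(z_0)\|f_0(z_0)\|=1$, $\|f-f_0\|_{v_p}<\varepsilon$ and $\|\lambda v_p(z)\delta_z-\lambda_0v_p(z_0)\delta_{z_0}\|<\varepsilon$. (2) $\mathbb T\mathrm{At}$ is norm-closed in $G^\infty_{v_p}(\mathbb D)$, and it is a set of uniformly strongly exposed points of the closed unit ball $B$ of $G^\infty_{v_p}(\mathbb D)$, in the following way. For $z\in\mathbb D$ let $$f_z(w)=\left(\frac{1-|z|^2}{(1-\overline z w)^2}\right)^p\qquad(w\in\mathbb D)$$ (principal branch). Then $f_z\in H^\infty_{v_p}(\mathbb D)$, $\mathbb T\mathrm{At}$ lies in the unit sphere of $G^\infty_{v_p}(\mathbb D)$, and the functionals $\Phi_x$, $x\in\mathbb T\mathrm{At}$,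 given by $\Phi_x(\phi)=\phi(\overline\lambda f_z)$ if $x=\lambda v_p(z)\delta_z$, are well defined on $G^\infty_{v_p}(\mathbb D)$ and satisfy $\|\Phi_x\|=1$ and $\Phi_x(x)=1$; moreover, for every $0<\varepsilon<1$ there is $0<\delta<1$ such that $\operatorname{diam}\{\phi\in B:\operatorname{Re}\Phi_x(\phi)>1-\delta\}<\varepsilon$ for all $x\in\mathbb T\mathrm{At}$. -/

import Mathlib

open TopologicalSpace Metric

noncomputable section

namespace WHol

variable {E : Type*} [NormedAddCommGroup E] [NormedSpace ℂ E]
variable {F : Type*} [NormedAddCommGroup F] [NormedSpace ℂ F]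

/-- A mapping `f : U → F` on an open set `U` of a complex normed space is holomorphic: it is the
restriction of a mapping that is complex (Fréchet) differentiable at the points of `U`. -/
def IsHol {U : Opens E} (f : U → F) : Prop :=
  ∃ g : E → F, DifferentiableOn ℂ g (U : Set E) ∧ ∀ z : U, g z = f z

/-- A weight on `U`: a strictly positive continuous function. -/
structure Weight (U : Opens E) where
  toFun : U → ℝ
  continuous_toFun : Continuous toFun
  pos : ∀ z, 0 < toFun z

instance {U : Opens E} : CoeFun (Weight U) (fun _ => U → ℝ) := ⟨Weight.toFun⟩

theorem IsHol.continuous {U : Opens E} {f : U → F} (hf : IsHol f) : Continuous f := by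
  obtain ⟨g, hg, h⟩ := hf
  have : f = fun z : U => g z := funext fun z => (h z).symm
  rw [this]
  exact hg.continuousOn.comp_continuous continuous_subtype_val fun z => z.2

/-- The vector space of the holomorphic mappings `f : U → F` with `v ‖f‖` bounded on `U`. -/
def weightedSubmodule {U : Opens E} (v : Weight U) (F : Type*) [NormedAddCommGroup F]
    [NormedSpace ℂ F] : Submodule ℂ (U → F) where
  carrier := {f | IsHol f ∧ BddAbove (Set.range fun z => v z * ‖f z‖)}
  zero_mem' := ⟨⟨0, differentiableOn_const 0, fun _ => rfl⟩, 0, by rintro _ ⟨z, rfl⟩; simp⟩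
  add_mem' := by
    rintro f₁ f₂ ⟨⟨g₁, hg₁, h₁⟩, C₁, hC₁⟩ ⟨⟨g₂, hg₂, h₂⟩, C₂, hC₂⟩
    refine ⟨⟨g₁ + g₂, hg₁.add hg₂, fun z => by simp [h₁, h₂]⟩, C₁ + C₂, ?_⟩
    rintro _ ⟨z, rfl⟩
    have a₁ := hC₁ ⟨z, rfl⟩
    have a₂ := hC₂ ⟨z, rfl⟩
    have a₃ := mul_le_mul_of_nonneg_left (norm_add_le (f₁ z) (f₂ z)) (v.pos z).le
    simp only [Pi.add_apply] at *
    linarith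
  smul_mem' := by
    rintro c f ⟨⟨g, hg, h⟩, C, hC⟩
    refine ⟨⟨c • g, hg.const_smul c, fun z => by simp [h]⟩, ‖c‖ * C, ?_⟩
    rintro _ ⟨z, rfl⟩
    have a := mul_le_mul_of_nonneg_left (hC ⟨z, rfl⟩) (norm_nonneg c)
    simp only [Pi.smul_apply, norm_smul] at *
    linarith

/-- The weighted space of holomorphic mappings `H^∞_v(U, F)`, normed below by the weighted
supremum norm. -/
def HInf {U : Opens E} (v : Weight U) (F : Type*) [NormedAddCommGroup F] [NormedSpace ℂ F] :
    Type _ := ↥(weightedSubmodule v F)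

section HInf

variable {U : Opens E} (v : Weight U)

instance : AddCommGroup (HInf v F) := inferInstanceAs (AddCommGroup ↥(weightedSubmodule v F))

instance : Module ℂ (HInf v F) := inferInstanceAs (Module ℂ ↥(weightedSubmodule v F))

instance : CoeFun (HInf v F) (fun _ => U → F) := ⟨Subtype.val⟩

/-- The weighted supremum norm `‖f‖_v = sup {v(z) ‖f(z)‖ : z ∈ U}`. -/
instance : Norm (HInf v F) := ⟨fun f => ⨆ z : U, v z * ‖f z‖⟩

variable {v}

theorem HInf.norm_def (f : HInf v F) : ‖f‖ = ⨆ z : U, v z * ‖f z‖ := rfl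

theorem HInf.add_apply (f g : HInf v F) (z : U) : (f + g) z = f z + g z := rfl

theorem HInf.smul_apply (c : ℂ) (f : HInf v F) (z : U) : (c • f) z = c • f z := rfl

theorem HInf.continuous (f : HInf v F) : Continuous (f : U → F) := f.2.1.continuous

theorem HInf.le_norm (f : HInf v F) (z : U) : v z * ‖f z‖ ≤ ‖f‖ := le_ciSup f.2.2 z

variable (v)

theorem HInf.core : NormedSpace.Core ℂ (HInf v F) where
  norm_nonneg f := Real.iSup_nonneg fun z => mul_nonneg (v.pos z).le (norm_nonneg _)
  norm_smul c f := by
    rw [HInf.norm_def, HInf.norm_def, Real.mul_iSup_of_nonneg (norm_nonneg c)]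
    congr 1
    funext z
    rw [HInf.smul_apply, norm_smul]
    ring
  norm_triangle f g := by
    refine Real.iSup_le (fun z => ?_) (add_nonneg
      (Real.iSup_nonneg fun z => mul_nonneg (v.pos z).le (norm_nonneg _))
      (Real.iSup_nonneg fun z => mul_nonneg (v.pos z).le (norm_nonneg _)))
    have a₁ := HInf.le_norm f z
    have a₂ := HInf.le_norm g z
    have a₃ := mul_le_mul_of_nonneg_left (norm_add_le (f z) (g z)) (v.pos z).le
    rw [HInf.add_apply]
    linarith
  norm_eq_zero_iff f := by
    constructor
    · intro h
      refine Subtype.ext (funext fun z => ?_)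
      have a := HInf.le_norm f z
      rw [h] at a
      have b := nonpos_of_mul_nonpos_right a (v.pos z)
      exact norm_le_zero_iff.1 b
    · rintro rfl
      rw [HInf.norm_def]
      have : ∀ z : U, v z * ‖(0 : HInf v F) z‖ = 0 := fun z => by
        have : (0 : HInf v F) z = 0 := rfl
        simp [this]
      simp [this]

instance : NormedAddCommGroup (HInf v F) := NormedAddCommGroup.ofCore (HInf.core v)

instance : NormedSpace ℂ (HInf v F) := NormedSpace.ofCore (HInf.core v)

/-- The compact-open topology `τ₀` on `H^∞_v(U) = H^∞_v(U, ℂ)`. -/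
@[reducible]
def tau0 : TopologicalSpace (HInf v ℂ) :=
  TopologicalSpace.induced (fun f => (⟨f, f.continuous⟩ : C(U, ℂ))) inferInstance

/-- `G^∞_v(U)`: the linear functionals on `H^∞_v(U)` whose restriction to the closed unit ball is
`τ₀`-continuous, as a subspace of the normed dual of `H^∞_v(U)`, whose norm it carries. (A linear
functional with `τ₀`-continuous restriction to the closed unit ball is automatically bounded.) -/
def GInf : Submodule ℂ (StrongDual ℂ (HInf v ℂ)) where
  carrier := {φ | @ContinuousOn _ _ (tau0 v) _ φ (closedBall 0 1)}
  zero_mem' := by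
    let _ := tau0 v
    exact continuousOn_const
  add_mem' := by
    intro φ ψ hφ hψ
    let _ := tau0 v
    exact ContinuousOn.add (f := φ) (g := ψ) hφ hψ
  smul_mem' := by
    intro c φ hφ
    let _ := tau0 v
    exact ContinuousOn.const_smul (g := φ) hφ c

/-- The evaluation functional `δ_z(f) = f(z)` as an element of the dual of `H^∞_v(U)`. -/
def evalDual (z : U) : StrongDual ℂ (HInf v ℂ) :=
  LinearMap.mkContinuous
    { toFun := fun f => f z
      map_add' := fun _ _ => rfl
      map_smul' := fun _ _ => rfl } (v z)⁻¹ fun f => by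
    have a := HInf.le_norm f z
    rw [inv_mul_eq_div, le_div_iff₀ (v.pos z), mul_comm]
    exact a

theorem evalDual_mem (z : U) : evalDual v z ∈ GInf v := by
  let _ := tau0 v
  have h : Continuous fun f : HInf v ℂ => (⟨f, f.continuous⟩ : C(U, ℂ)) := continuous_induced_dom
  exact ((continuous_eval_const z).comp h).continuousOn

/-- The evaluation functional `δ_z` as an element of `G^∞_v(U)`. -/
def delta (z : U) : GInf v := ⟨evalDual v z, evalDual_mem v z⟩

/-- The set of the atoms `v(z) δ_z`, `z ∈ U`, of `G^∞_v(U)`. -/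
def atoms : Set (GInf v) := Set.range fun z => (v z : ℂ) • delta v z

/-- The set `𝕋 · At` of the products of a unimodular scalar and an atom. -/
def circleAtoms : Set (GInf v) :=
  {x | ∃ c : ℂ, ‖c‖ = 1 ∧ ∃ a ∈ atoms v, x = c • a}

variable {v}

/-- The evaluation mapping `J_v : H^∞_v(U) → G^∞_v(U)^*`, `J_v(f)(φ) = φ(f)`. -/
def evalMap (f : HInf v ℂ) : StrongDual ℂ (GInf v) :=
  (ContinuousLinearMap.apply ℂ ℂ f).comp (GInf v).subtypeL

variable (v)

/-- The weighted holomorphic Bishop–Phelps–Bollobás property of `H^∞_v(U, F)`. -/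
def HasBPB (F : Type*) [NormedAddCommGroup F] [NormedSpace ℂ F] : Prop :=
  ∀ ε : ℝ, 0 < ε → ε < 1 → ∃ η : ℝ, 0 < η ∧ η < ε ∧
    ∀ f : HInf v F, ‖f‖ = 1 → ∀ c : ℂ, ‖c‖ = 1 → ∀ z : U, v z * ‖f z‖ > 1 - η →
      ∃ f₀ : HInf v F, ‖f₀‖ = 1 ∧ ∃ c₀ : ℂ, ‖c₀‖ = 1 ∧ ∃ z₀ : U,
        v z₀ * ‖f₀ z₀‖ = 1 ∧ ‖f - f₀‖ < ε ∧
        ‖c • (v z : ℂ) • delta v z - c₀ • (v z₀ : ℂ) • delta v z₀‖ < ε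

end HInf

section Exposed

variable {X : Type*} [NormedAddCommGroup X] [NormedSpace ℂ X]

/-- The slice `{x ∈ B_X : Re f(x) > 1 - δ}` of the closed unit ball. -/
def slice (f : StrongDual ℂ X) (δ : ℝ) : Set X := {x | ‖x‖ ≤ 1 ∧ (f x).re > 1 - δ}

/-- `S ⊆ S_X` and the unit ball of `X` is uniformly strongly exposed by the family of norm-one
functionals `Φ x`, `x ∈ S` (the values of `Φ` outside `S` play no role). -/
def UniformlyStronglyExposedBy (S : Set X) (Φ : X → StrongDual ℂ X) : Prop :=
  S ⊆ sphere 0 1 ∧ (∀ x ∈ S, ‖Φ x‖ = 1 ∧ Φ x x = 1) ∧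
    ∀ ε : ℝ, 0 < ε → ε < 1 → ∃ δ : ℝ, 0 < δ ∧ δ < 1 ∧ ∀ x ∈ S, diam (slice (Φ x) δ) < ε

end Exposed

/-- The open unit disc of `ℂ`. -/
def disc : Opens ℂ := ⟨ball 0 1, isOpen_ball⟩

theorem one_sub_pos (z : disc) : 0 < 1 - ‖(z : ℂ)‖ ^ 2 := by
  have h : ‖(z : ℂ)‖ < 1 := mem_ball_zero_iff.1 z.2
  nlinarith [norm_nonneg (z : ℂ)]

/-- The polynomial weight `v_p(z) = (1 - |z|²)^p` on the unit disc. -/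
def polyWeight (p : ℝ) : Weight disc where
  toFun z := (1 - ‖(z : ℂ)‖ ^ 2) ^ p
  continuous_toFun := by
    refine Continuous.rpow_const (by fun_prop) fun z => Or.inl (one_sub_pos z).ne'
  pos z := Real.rpow_pos_of_pos (one_sub_pos z) p

/-- `((1 - |z|²) / (1 - z̄ w)²)^p`, the `p`-th power (principal branch; the base is in the slit
plane for `z, w` in the disc) of the derivative at `w` of the disc automorphism
`w ↦ (w - z) / (1 - z̄ w)`. -/
def mobiusDerivPow (p : ℝ) (z w : ℂ) : ℂ :=
  ((1 - (‖z‖ : ℂ) ^ 2) / (1 - (starRingEnd ℂ) z * w) ^ 2) ^ (p : ℂ)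

end WHol

end

/-! Write ρ for the pseudo-hyperbolic distance `‖mobius z w‖`. Everything rests on the identity
v_p(w)|f_z(w)| = (1 - ρ²)^p (`weight_mul_norm_mobiusDerivPow`): f_z peaks at z, and since p ≥ 1 its
weighted modulus is at most 1 - ρ², uniformly in z. A function h with h(z) = 0 has weighted modulus
O(ρ) near z by Schwarz (`weight_mul_norm_le_of_apply_eq_zero`), so the quadratic drop of f_z absorbs
a small multiple of h and ‖f_z + t h‖ = 1 + O(|t|²) (`norm_peak_add_le`). This is uniform smoothness
of the norm at f_z; by Šmulian-type duality a functional in the dual ball almost norming f_z is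
close to v_p(z) δ_z (`norm_sub_smul_evalDual_le`). Strong exposition follows, with constants
independent of z. Closedness and the Bishop–Phelps–Bollobás property add compactness of
pseudo-hyperbolic balls. For the latter, f is perturbed by a small multiple of f_z · v_p(z) f(z):
the new weighted norm is attained at a point where f_z is almost maximal, and such a point has its
atom close to that of z, up to a phase. -/

namespace WHol

/-! ### Disc automorphisms and powers of their derivatives. -/

section Mobius

/-- The disc automorphism `w ↦ (w - z) / (1 - z̄ w)`. -/
noncomputable def mobius (z w : ℂ) : ℂ := (w - z) / (1 - (starRingEnd ℂ) z * w)

variable {z w : ℂ}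

theorem re_one_sub_conj_mul_pos (hz : ‖z‖ < 1) (hw : ‖w‖ < 1) :
    0 < (1 - (starRingEnd ℂ) z * w).re := by
  have h : ((starRingEnd ℂ) z * w).re ≤ ‖z‖ * ‖w‖ :=
    (Complex.re_le_norm _).trans (by simp)
  have h' : ‖z‖ * ‖w‖ < 1 := by nlinarith [norm_nonneg z, norm_nonneg w]
  rw [Complex.sub_re, Complex.one_re]
  linarith

theorem one_sub_conj_mul_ne_zero (hz : ‖z‖ < 1) (hw : ‖w‖ < 1) :
    1 - (starRingEnd ℂ) z * w ≠ 0 := fun h => by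
  have := re_one_sub_conj_mul_pos hz hw
  simp [h] at this

/-- Clearing denominators leaves |1 - z̄w|² - |w - z|² = (1 - |z|²)(1 - |w|²), a polynomial identity
in real and imaginary parts. -/
theorem one_sub_norm_mobius_sq (hz : ‖z‖ < 1) (hw : ‖w‖ < 1) :
    1 - ‖mobius z w‖ ^ 2 =
      (1 - ‖z‖ ^ 2) * (1 - ‖w‖ ^ 2) / ‖1 - (starRingEnd ℂ) z * w‖ ^ 2 := by
  have h : ‖1 - (starRingEnd ℂ) z * w‖ ^ 2 ≠ 0 :=
    pow_ne_zero _ (norm_ne_zero_iff.2 (one_sub_conj_mul_ne_zero hz hw))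
  rw [mobius, norm_div, div_pow, eq_div_iff h, sub_mul, div_mul_cancel₀ _ h]
  simp only [Complex.sq_norm, Complex.normSq_apply, Complex.sub_re, Complex.sub_im,
    Complex.mul_re, Complex.mul_im, Complex.conj_re, Complex.conj_im, Complex.one_re,
    Complex.one_im]
  ring

theorem norm_mobius_lt_one (hz : ‖z‖ < 1) (hw : ‖w‖ < 1) : ‖mobius z w‖ < 1 := by
  have h : 0 < 1 - ‖mobius z w‖ ^ 2 := by
    rw [one_sub_norm_mobius_sq hz hw]
    have := norm_pos_iff.2 (one_sub_conj_mul_ne_zero hz hw)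
    have h₁ : 0 < 1 - ‖z‖ ^ 2 := by nlinarith [norm_nonneg z]
    have h₂ : 0 < 1 - ‖w‖ ^ 2 := by nlinarith [norm_nonneg w]
    positivity
  nlinarith [norm_nonneg (mobius z w)]

theorem mobius_neg_mobius (hz : ‖z‖ < 1) (hw : ‖w‖ < 1) : mobius (-z) (mobius z w) = w := by
  have h := one_sub_conj_mul_ne_zero hz hw
  have h' : 1 - (starRingEnd ℂ) (-z) * mobius z w ≠ 0 :=
    one_sub_conj_mul_ne_zero (by simpa using hz) (norm_mobius_lt_one hz hw)
  rw [mobius, div_eq_iff h']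
  rw [mobius, map_neg]
  rw [mul_comm] at h
  field_simp
  ring

theorem mobius_mobius_neg (hz : ‖z‖ < 1) (hw : ‖w‖ < 1) : mobius z (mobius (-z) w) = w := by
  simpa using mobius_neg_mobius (z := -z) (by simpa using hz) hw

theorem differentiableOn_mobius (hz : ‖z‖ < 1) :
    DifferentiableOn ℂ (mobius z) (ball 0 1) := by
  refine DifferentiableOn.div (by fun_prop) (by fun_prop) fun w hw => ?_
  exact one_sub_conj_mul_ne_zero hz (mem_ball_zero_iff.1 hw)

/-- The inverse of 1 - z̄w has positive real part, so its square misses the closed negative axis;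
this makes the principal branch holomorphic. -/
theorem mobiusDerivPow_base_mem_slitPlane (hz : ‖z‖ < 1) (hw : ‖w‖ < 1) :
    (1 - (‖z‖ : ℂ) ^ 2) / (1 - (starRingEnd ℂ) z * w) ^ 2 ∈ Complex.slitPlane := by
  have hB := re_one_sub_conj_mul_pos hz hw
  set B := 1 - (starRingEnd ℂ) z * w with hBdef
  have hA : 0 < 1 - ‖z‖ ^ 2 := by nlinarith [norm_nonneg z]
  have hC : 0 < (B⁻¹).re := by
    rw [Complex.inv_re]
    refine div_pos hB (Complex.normSq_pos.2 ?_)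
    rintro h
    simp [h] at hB
  have h : (1 - (‖z‖ : ℂ) ^ 2) / B ^ 2 = ((1 - ‖z‖ ^ 2 : ℝ) : ℂ) * (B⁻¹ * B⁻¹) := by
    push_cast
    rw [div_eq_mul_inv, sq B, mul_inv]
  rw [h, Complex.mem_slitPlane_iff, Complex.re_ofReal_mul, Complex.im_ofReal_mul,
    Complex.mul_re, Complex.mul_im]
  by_cases hi : (B⁻¹).im = 0
  · left
    rw [hi]
    have := mul_pos hA (mul_pos hC hC)
    linarith
  · right
    have h₁ := mul_ne_zero hC.ne' hi
    refine mul_ne_zero hA.ne' fun h₂ => h₁ (by linarith)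

theorem differentiableOn_mobiusDerivPow (p : ℝ) (hz : ‖z‖ < 1) :
    DifferentiableOn ℂ (mobiusDerivPow p z) (ball 0 1) := by
  refine DifferentiableOn.cpow_const (DifferentiableOn.div (by fun_prop) (by fun_prop)
    fun w hw => ?_) fun w hw => ?_
  · exact pow_ne_zero _ (one_sub_conj_mul_ne_zero hz (mem_ball_zero_iff.1 hw))
  · exact mobiusDerivPow_base_mem_slitPlane hz (mem_ball_zero_iff.1 hw)

theorem mobiusDerivPow_ne_zero (p : ℝ) (hz : ‖z‖ < 1) (hw : ‖w‖ < 1) :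
    mobiusDerivPow p z w ≠ 0 := by
  have h := Complex.slitPlane_ne_zero (mobiusDerivPow_base_mem_slitPlane hz hw)
  exact fun h0 => h (Complex.cpow_eq_zero_iff _ _ |>.1 h0).1

theorem weight_mul_norm_mobiusDerivPow (p : ℝ) (hz : ‖z‖ < 1) (hw : ‖w‖ < 1) :
    (1 - ‖w‖ ^ 2) ^ p * ‖mobiusDerivPow p z w‖ = (1 - ‖mobius z w‖ ^ 2) ^ p := by
  have hA : 0 < 1 - ‖z‖ ^ 2 := by nlinarith [norm_nonneg z]
  have hW : 0 < 1 - ‖w‖ ^ 2 := by nlinarith [norm_nonneg w]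
  have h : ‖(1 - (‖z‖ : ℂ) ^ 2)‖ = 1 - ‖z‖ ^ 2 := by
    have : (1 - (‖z‖ : ℂ) ^ 2) = ((1 - ‖z‖ ^ 2 : ℝ) : ℂ) := by push_cast; rfl
    rw [this, Complex.norm_real, Real.norm_of_nonneg hA.le]
  rw [mobiusDerivPow, Complex.norm_cpow_real, ← Real.mul_rpow hW.le (norm_nonneg _),
    one_sub_norm_mobius_sq hz hw, norm_div, norm_pow, h]
  ring_nf

theorem weight_mul_mobiusDerivPow_self (p : ℝ) (hz : ‖z‖ < 1) :
    (((1 - ‖z‖ ^ 2) ^ p : ℝ) : ℂ) * mobiusDerivPow p z z = 1 := by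
  have hA : 0 < 1 - ‖z‖ ^ 2 := by nlinarith [norm_nonneg z]
  have h : (1 - (‖z‖ : ℂ) ^ 2) / (1 - (starRingEnd ℂ) z * z) ^ 2 =
      (((1 - ‖z‖ ^ 2)⁻¹ : ℝ) : ℂ) := by
    rw [← Complex.normSq_eq_conj_mul_self, Complex.normSq_eq_norm_sq]
    have : (1 - (‖z‖ : ℂ) ^ 2) ≠ 0 := by
      have : (1 - (‖z‖ : ℂ) ^ 2) = ((1 - ‖z‖ ^ 2 : ℝ) : ℂ) := by push_cast; rfl
      rw [this]
      exact_mod_cast hA.ne'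
    push_cast
    field_simp
  rw [mobiusDerivPow, h, ← Complex.ofReal_cpow (inv_pos.2 hA).le, ← Complex.ofReal_mul,
    ← Real.mul_rpow hA.le (inv_pos.2 hA).le, mul_inv_cancel₀ hA.ne', Real.one_rpow,
    Complex.ofReal_one]

end Mobius

/-! ### Norm estimates on general weighted spaces. -/

section General

variable {E : Type*} [NormedAddCommGroup E] [NormedSpace ℂ E]
variable {F : Type*} [NormedAddCommGroup F] [NormedSpace ℂ F]
variable {U : Opens E} {v : Weight U}

theorem HInf.norm_le {f : HInf v F} {C : ℝ} (hC : 0 ≤ C) (h : ∀ z, v z * ‖f z‖ ≤ C) :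
    ‖f‖ ≤ C := Real.iSup_le h hC

theorem evalDual_apply (z : U) (f : HInf v ℂ) : evalDual v z f = f z := rfl

theorem norm_smul_evalDual_le (z : U) : ‖(v z : ℂ) • evalDual v z‖ ≤ 1 := by
  refine ContinuousLinearMap.opNorm_le_bound _ zero_le_one fun f => ?_
  rw [smul_apply, evalDual_apply, norm_smul, Complex.norm_real,
    Real.norm_of_nonneg (v.pos z).le, one_mul]
  exact f.le_norm z

theorem evalMap_apply (f : HInf v ℂ) (φ : GInf v) :
    evalMap f φ = (φ : StrongDual ℂ (HInf v ℂ)) f := rfl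

theorem norm_evalMap_apply_le (f : HInf v ℂ) (φ : GInf v) : ‖evalMap f φ‖ ≤ ‖f‖ * ‖φ‖ := by
  rw [mul_comm]
  exact (φ : StrongDual ℂ (HInf v ℂ)).le_opNorm f

theorem norm_eq_one_of_apply_eq_one {X : Type*} [NormedAddCommGroup X] [NormedSpace ℂ X]
    {Φ : StrongDual ℂ X} (hΦ : ∀ x, ‖Φ x‖ ≤ ‖x‖) {x : X} (hx : ‖x‖ ≤ 1) (h : Φ x = 1) :
    ‖Φ‖ = 1 := by
  refine le_antisymm (ContinuousLinearMap.opNorm_le_bound _ zero_le_one fun x => ?_) ?_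
  · simpa using hΦ x
  · have := (Φ.le_opNorm x).trans (mul_le_of_le_one_right (norm_nonneg _) hx)
    simpa [h] using this

end General

/-! ### Peak functions and smoothness of the norm at them. -/

section Peak

variable {p : ℝ}

theorem norm_coe_lt_one (z : disc) : ‖(z : ℂ)‖ < 1 := mem_ball_zero_iff.1 z.2

theorem one_sub_norm_mobius_sq_pos (z w : disc) : 0 < 1 - ‖mobius z w‖ ^ 2 := by
  nlinarith [norm_nonneg (mobius z w),
    norm_mobius_lt_one (norm_coe_lt_one z) (norm_coe_lt_one w)]

theorem one_sub_norm_mobius_sq_rpow_le_one (hp : 0 ≤ p) (z w : disc) :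
    (1 - ‖mobius z w‖ ^ 2) ^ p ≤ 1 :=
  Real.rpow_le_one (one_sub_norm_mobius_sq_pos z w).le
    (by linarith [sq_nonneg ‖mobius z w‖]) hp

/-- The function `f_z`, which attains its norm exactly at `z`. -/
noncomputable def peak (hp : 0 ≤ p) (z : disc) : HInf (polyWeight p) ℂ :=
  ⟨fun w => mobiusDerivPow p z w,
    ⟨mobiusDerivPow p z, differentiableOn_mobiusDerivPow p (norm_coe_lt_one z), fun _ => rfl⟩, 1, by
      rintro _ ⟨w, rfl⟩
      exact (weight_mul_norm_mobiusDerivPow p (norm_coe_lt_one z) (norm_coe_lt_one w)).trans_le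
        (one_sub_norm_mobius_sq_rpow_le_one hp z w)⟩

theorem peak_apply (hp : 0 ≤ p) (z w : disc) : peak hp z w = mobiusDerivPow p z w := rfl

theorem weight_mul_norm_peak (hp : 0 ≤ p) (z w : disc) :
    polyWeight p w * ‖peak hp z w‖ = (1 - ‖mobius z w‖ ^ 2) ^ p :=
  weight_mul_norm_mobiusDerivPow p (norm_coe_lt_one z) (norm_coe_lt_one w)

theorem weight_mul_peak_self (hp : 0 ≤ p) (z : disc) :
    (polyWeight p z : ℂ) * peak hp z z = 1 :=
  weight_mul_mobiusDerivPow_self p (norm_coe_lt_one z)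

theorem norm_peak_le (hp : 0 ≤ p) (z : disc) : ‖peak hp z‖ ≤ 1 :=
  HInf.norm_le zero_le_one fun w => (weight_mul_norm_peak hp z w).trans_le
    (one_sub_norm_mobius_sq_rpow_le_one hp z w)

/-- A Schwarz lemma: a function of norm at most `2` vanishing at `z` is small near `z`, in terms of
the pseudo-hyperbolic distance to `z`. -/
theorem weight_mul_norm_le_of_apply_eq_zero (hp : 0 ≤ p) {h : HInf (polyWeight p) ℂ} {z : disc}
    (hz : h z = 0) (hh : ‖h‖ ≤ 2) {w : disc} (hw : ‖mobius z w‖ < 1 / 2) :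
    polyWeight p w * ‖h w‖ ≤ 8 * 2 ^ p * ‖mobius z w‖ := by
  obtain ⟨g, hg, hgh⟩ := h.2.1
  have hz1 := norm_coe_lt_one z
  have hz1' : ‖-(z : ℂ)‖ < 1 := by rwa [norm_neg]
  have hsub : ball (0 : ℂ) (1 / 2) ⊆ ball 0 1 := ball_subset_ball (by norm_num)
  have hmaps : Set.MapsTo (mobius (-z)) (ball 0 (1 / 2)) (ball 0 1) := fun u hu =>
    mem_ball_zero_iff.2 (norm_mobius_lt_one hz1' (mem_ball_zero_iff.1 (hsub hu)))
  -- Dividing by f_z and moving z to the origin turns the weight at the image point into (1 -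
  -- |u|²)^p, which is at least 2^(-p) for |u| < 1/2; the classical Schwarz lemma then applies to
  -- `k`.
  set k : ℂ → ℂ := fun u => g (mobius (-z) u) / mobiusDerivPow p z (mobius (-z) u) with hk
  have hkd : DifferentiableOn ℂ k (ball 0 (1 / 2)) :=
    ((hg.comp ((differentiableOn_mobius hz1').mono hsub) hmaps)).div
      ((differentiableOn_mobiusDerivPow p hz1).comp ((differentiableOn_mobius hz1').mono hsub) hmaps)
      fun u hu => mobiusDerivPow_ne_zero p hz1 (mem_ball_zero_iff.1 (hmaps hu))
  have hm0 : mobius (-(z : ℂ)) 0 = z := by simp [mobius]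
  have hk0 : k 0 = 0 := by
    simp only [hk, hm0]
    rw [hgh z]
    have : h z = 0 := hz
    rw [this, zero_div]
  have key : ∀ u : disc, (1 - ‖mobius z u‖ ^ 2) ^ p *
      ‖g u / mobiusDerivPow p z u‖ = polyWeight p u * ‖h u‖ := fun u => by
    rw [← weight_mul_norm_peak hp z u, norm_div, peak_apply, hgh u, mul_assoc,
      mul_div_cancel₀ _ (norm_ne_zero_iff.2 (mobiusDerivPow_ne_zero p hz1 (norm_coe_lt_one u)))]
  have hkm : Set.MapsTo k (ball 0 (1 / 2)) (closedBall (k 0) (4 * 2 ^ p)) := by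
    intro u hu
    rw [hk0, mem_closedBall_zero_iff]
    have h₁ := (key ⟨_, hmaps hu⟩).trans_le ((HInf.le_norm h _).trans hh)
    have hu2 : ‖u‖ < 1 / 2 := mem_ball_zero_iff.1 hu
    simp only [mobius_mobius_neg hz1 (mem_ball_zero_iff.1 (hsub hu))] at h₁
    have h₂ : (1 / 2 : ℝ) ^ p ≤ (1 - ‖u‖ ^ 2) ^ p :=
      Real.rpow_le_rpow (by norm_num) (by nlinarith [norm_nonneg u]) hp
    have h₃ : (1 / 2 : ℝ) ^ p * 2 ^ p = 1 := by
      rw [← Real.mul_rpow (by norm_num) (by norm_num)]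
      norm_num
    have h₄ : (0 : ℝ) < 2 ^ p := Real.rpow_pos_of_pos (by norm_num) p
    have h₅ : (1 / 2 : ℝ) ^ p * ‖k u‖ ≤ 2 :=
      (mul_le_mul_of_nonneg_right h₂ (norm_nonneg _)).trans h₁
    calc ‖k u‖ = 2 ^ p * ((1 / 2 : ℝ) ^ p * ‖k u‖) := by
          rw [← mul_assoc, mul_comm (2 ^ p : ℝ), h₃, one_mul]
      _ ≤ 2 ^ p * 2 := by gcongr
      _ ≤ 4 * 2 ^ p := by linarith
  -- The bound 4 · 2^p over the radius 1/2 gives the constant 8 · 2^p.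
  have hS := Complex.dist_le_div_mul_dist_of_mapsTo_ball hkd hkm (mem_ball_zero_iff.2 hw)
  rw [hk0, dist_zero_right, dist_zero_right] at hS
  simp only [hk, mobius_neg_mobius hz1 (norm_coe_lt_one w)] at hS
  rw [← key w]
  refine (mul_le_of_le_one_left (norm_nonneg _)
    (one_sub_norm_mobius_sq_rpow_le_one hp z w)).trans (hS.trans_eq ?_)
  ring

/-- With C = 8 · 2^p, near z the weighted modulus is at most 1 - ρ² + Cρ|t|, and completing the
square leaves only a term of order |t|². For ρ ≥ 1/2 the peak is at most 3/4 and the perturbation at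
most 2/8, which is where the bound on `t` comes from. -/
theorem norm_peak_add_le (hp : 1 ≤ p) {h : HInf (polyWeight p) ℂ} {z : disc}
    (hz : h z = 0) (hh : ‖h‖ ≤ 2) {t : ℂ} (ht : ‖t‖ ≤ 1 / 8) :
    ‖peak (zero_le_one.trans hp) z + t • h‖ ≤ 1 + (8 * 2 ^ p) ^ 2 * ‖t‖ ^ 2 := by
  refine HInf.norm_le (by positivity) fun w => ?_
  have hv := ((polyWeight p).pos w).le
  have h₁ : polyWeight p w * ‖(peak (zero_le_one.trans hp) z + t • h) w‖ ≤
      (1 - ‖mobius z w‖ ^ 2) ^ p + ‖t‖ * (polyWeight p w * ‖h w‖) := by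
    rw [← weight_mul_norm_peak (zero_le_one.trans hp) z w, HInf.add_apply, HInf.smul_apply]
    refine (mul_le_mul_of_nonneg_left (norm_add_le _ _) hv).trans_eq ?_
    rw [norm_smul]
    ring
  have h₂ : (1 - ‖mobius z w‖ ^ 2) ^ p ≤ 1 - ‖mobius z w‖ ^ 2 :=
    Real.rpow_le_self_of_le_one (one_sub_norm_mobius_sq_pos z w).le
      (by linarith [sq_nonneg ‖mobius z w‖]) hp
  refine h₁.trans ((add_le_add_left h₂ _).trans ?_)
  rcases lt_or_ge ‖mobius z w‖ (1 / 2) with hw | hw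
  · have h₃ := mul_le_mul_of_nonneg_left
      (weight_mul_norm_le_of_apply_eq_zero (zero_le_one.trans hp) hz hh hw) (norm_nonneg t)
    nlinarith [sq_nonneg (‖mobius z w‖ - 8 * 2 ^ p * ‖t‖), sq_nonneg ‖mobius z w‖,
      sq_nonneg (8 * 2 ^ p * ‖t‖)]
  · have h₃ := mul_le_mul ht ((HInf.le_norm h w).trans hh)
      (mul_nonneg hv (norm_nonneg _)) (by norm_num)
    have : 0 ≤ (8 * 2 ^ p) ^ 2 * ‖t‖ ^ 2 := by positivity
    nlinarith

/-- A functional of norm at most one that nearly attains its norm at `f_z` is near `v_p(z) δ_z`. -/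
theorem norm_sub_smul_evalDual_le (hp : 1 ≤ p) {φ : StrongDual ℂ (HInf (polyWeight p) ℂ)}
    (hφ : ‖φ‖ ≤ 1) {z : disc} {t : ℝ} (ht : 0 < t) (ht' : t ≤ 1 / 8)
    (hφt : (φ (peak (zero_le_one.trans hp) z)).re > 1 - t ^ 2) :
    ‖φ - (polyWeight p z : ℂ) • evalDual (polyWeight p) z‖ ≤ (3 + (8 * 2 ^ p) ^ 2) * t := by
  set P := peak (zero_le_one.trans hp) z with hP
  have hle : ∀ f, ‖φ f‖ ≤ ‖f‖ := fun f =>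
    (φ.le_opNorm f).trans (mul_le_of_le_one_left (norm_nonneg f) hφ)
  -- A point of the closed unit disc with real part above 1 - t² is within √2 t of 1.
  have hP1 : ‖φ P - 1‖ ≤ 2 * t := by
    have h₁ : ‖φ P‖ ≤ 1 := (hle P).trans (norm_peak_le _ z)
    have h₂ : ‖φ P - 1‖ ^ 2 = ‖φ P‖ ^ 2 - 2 * (φ P).re + 1 := by
      simp only [Complex.sq_norm, Complex.normSq_apply, Complex.sub_re, Complex.sub_im,
        Complex.one_re, Complex.one_im]
      ring
    refine abs_le_of_sq_le_sq' ?_ (by positivity) |>.2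
    nlinarith [norm_nonneg (φ P)]
  have hzero : ∀ h : HInf (polyWeight p) ℂ, h z = 0 → ‖h‖ ≤ 2 →
      ‖φ h‖ ≤ (1 + (8 * 2 ^ p) ^ 2) * t := by
    intro h hz hh
    -- The phase `c` makes φ(t c h) = t‖φ h‖. Testing φ on P + t c h gives 1 - t² + t‖φ h‖ ≤ 1 + (8
    -- · 2^p)² t², and one factor t cancels.
    obtain ⟨c, hc, hch⟩ := RCLike.exists_norm_eq_mul_self (φ h)
    have hn : ‖((t : ℂ) * c)‖ = t := by
      rw [norm_mul, hc, mul_one, Complex.norm_real, Real.norm_of_nonneg ht.le]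
    have h₁ := (hle _).trans (norm_peak_add_le hp hz hh (t := (t : ℂ) * c) (hn.trans_le ht'))
    have h₂ := (Complex.re_le_norm _).trans h₁
    have h₃ : ((t : ℂ) * c) * φ h = ((t * ‖φ h‖ : ℝ) : ℂ) := by
      rw [mul_assoc, ← hch]
      simp
    rw [map_add, map_smul, smul_eq_mul, h₃, Complex.add_re, Complex.ofReal_re, hn] at h₂
    have h₄ : t * ‖φ h‖ ≤ t * ((1 + (8 * 2 ^ p) ^ 2) * t) := by
      linarith
    exact le_of_mul_le_mul_left h₄ ht
  have hC : (0 : ℝ) ≤ (8 * 2 ^ p) ^ 2 := by positivity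
  refine ContinuousLinearMap.opNorm_le_of_unit_norm (𝕜 := ℂ) (by positivity) fun g hg => ?_
  -- Split g = (g - aP) + aP: the first summand vanishes at z and has norm at most 2, and on P the
  -- difference of the functionals is φ P - 1.
  set a : ℂ := (polyWeight p z : ℂ) * g z with ha
  have ha1 : ‖a‖ ≤ 1 := by
    rw [ha, norm_mul, Complex.norm_real, Real.norm_of_nonneg ((polyWeight p).pos z).le]
    exact (HInf.le_norm g z).trans hg.le
  have h₁ : ‖φ (g + (-a) • P)‖ ≤ (1 + (8 * 2 ^ p) ^ 2) * t := by
    refine hzero _ ?_ ?_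
    · have := weight_mul_peak_self (zero_le_one.trans hp) z
      rw [HInf.add_apply, HInf.smul_apply, smul_eq_mul, ha]
      linear_combination (-g z) * this
    · refine (norm_add_le _ _).trans ?_
      have h₂ : ‖(-a) • P‖ ≤ 1 := by
        rw [norm_smul, norm_neg]
        exact mul_le_one₀ ha1 (norm_nonneg _) (norm_peak_le _ z)
      have h₃ : ‖g‖ ≤ 1 := hg.le
      linarith
  have h₂ : (φ - (polyWeight p z : ℂ) • evalDual (polyWeight p) z) g =
      φ (g + (-a) • P) + a * (φ P - 1) := by
    rw [sub_apply, smul_apply, evalDual_apply, map_add, map_smul, smul_eq_mul, smul_eq_mul, ha]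
    ring
  rw [h₂]
  refine (norm_add_le _ _).trans ?_
  have h₃ : ‖a * (φ P - 1)‖ ≤ 1 * (2 * t) := by
    rw [norm_mul]
    exact mul_le_mul ha1 hP1 (norm_nonneg _) zero_le_one
  linarith

end Peak

/-! ### Separation, compactness and closedness of the atoms. -/

section Atoms

variable {p : ℝ}

theorem smul_weight_evalDual_peak (hp : 0 ≤ p) (c : ℂ) (z : disc) :
    (c • (polyWeight p z : ℂ) • evalDual (polyWeight p) z) (peak hp z) = c := by
  rw [smul_apply, smul_apply, evalDual_apply, smul_eq_mul, smul_eq_mul, weight_mul_peak_self,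
    mul_one]

theorem norm_smul_weight_evalDual_le {c : ℂ} (hc : ‖c‖ = 1) (z : disc) :
    ‖c • (polyWeight p z : ℂ) • evalDual (polyWeight p) z‖ ≤ 1 := by
  rw [norm_smul, hc, one_mul]
  exact norm_smul_evalDual_le z

theorem conj_mul_self_of_norm_eq_one {c : ℂ} (hc : ‖c‖ = 1) : (starRingEnd ℂ) c * c = 1 := by
  rw [← Complex.normSq_eq_conj_mul_self, Complex.normSq_eq_norm_sq, hc]
  simp

/-- Multiplying φ by the conjugate of `c` reduces to `c = 1`. The uniformity of δ in the atom serves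
both the slices and the Bishop–Phelps–Bollobás property. -/
theorem exists_norm_sub_atom_le (hp : 1 ≤ p) {ε : ℝ} (hε : 0 < ε) :
    ∃ δ : ℝ, 0 < δ ∧ δ < 1 ∧ ∀ c : ℂ, ‖c‖ = 1 → ∀ z : disc,
      ∀ φ : StrongDual ℂ (HInf (polyWeight p) ℂ), ‖φ‖ ≤ 1 →
        ((starRingEnd ℂ) c * φ (peak (zero_le_one.trans hp) z)).re > 1 - δ →
        ‖φ - c • (polyWeight p z : ℂ) • evalDual (polyWeight p) z‖ ≤ ε := by
  have hC : (0 : ℝ) < 3 + (8 * 2 ^ p) ^ 2 := by positivity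
  set C : ℝ := 3 + (8 * 2 ^ p) ^ 2 with hCdef
  set t : ℝ := min (1 / 8) (ε / C) with ht
  have ht0 : 0 < t := lt_min (by norm_num) (div_pos hε hC)
  have ht8 : t ≤ 1 / 8 := min_le_left _ _
  have htε : C * t ≤ ε := by
    have := (le_div_iff₀ hC).1 (min_le_right (1 / 8) (ε / C))
    rwa [mul_comm]
  refine ⟨t ^ 2, by positivity, by nlinarith, fun c hc z φ hφ h => ?_⟩
  have hc' : ‖(starRingEnd ℂ) c‖ = 1 := by rw [RCLike.norm_conj, hc]
  have h₁ : ‖(starRingEnd ℂ) c • φ‖ ≤ 1 := by rwa [norm_smul, hc', one_mul]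
  have h₂ := norm_sub_smul_evalDual_le hp h₁ ht0 ht8 (z := z) h
  have h₃ : (starRingEnd ℂ) c • φ - (polyWeight p z : ℂ) • evalDual (polyWeight p) z =
      (starRingEnd ℂ) c • (φ - c • (polyWeight p z : ℂ) • evalDual (polyWeight p) z) := by
    rw [smul_sub, smul_smul _ c, conj_mul_self_of_norm_eq_one hc, one_smul]
  rw [h₃, norm_smul, hc', one_mul] at h₂
  exact h₂.trans htε

/-- Test the difference on f_z: the first atom gives `c`, the second a number of modulus (1 - ρ²)^p.
-/
theorem one_sub_rpow_le_norm_sub (hp : 0 ≤ p) {c c' : ℂ} (hc : ‖c‖ = 1) (hc' : ‖c'‖ = 1)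
    (z w : disc) : 1 - (1 - ‖mobius z w‖ ^ 2) ^ p ≤
      ‖c • (polyWeight p z : ℂ) • evalDual (polyWeight p) z -
        c' • (polyWeight p w : ℂ) • evalDual (polyWeight p) w‖ := by
  have h₁ := ((c • (polyWeight p z : ℂ) • evalDual (polyWeight p) z -
    c' • (polyWeight p w : ℂ) • evalDual (polyWeight p) w).le_opNorm (peak hp z)).trans
    (mul_le_of_le_one_right (norm_nonneg _) (norm_peak_le hp z))
  refine le_trans ?_ h₁
  rw [sub_apply, smul_weight_evalDual_peak]
  refine le_trans ?_ (norm_sub_norm_le _ _)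
  rw [smul_apply, smul_apply, evalDual_apply, norm_smul, norm_smul, hc, hc', one_mul,
    Complex.norm_real, Real.norm_of_nonneg ((polyWeight p).pos w).le, weight_mul_norm_peak]

theorem rpow_one_sub_norm_mobius_sq_le (hp : 1 ≤ p) (z w : disc) :
    (1 - ‖mobius z w‖ ^ 2) ^ p ≤ 1 - ‖mobius z w‖ ^ 2 :=
  Real.rpow_le_self_of_le_one (one_sub_norm_mobius_sq_pos z w).le
    (by linarith [sq_nonneg ‖mobius z w‖]) hp

theorem atom_injective (hp : 1 ≤ p) {c c' : ℂ} (hc : ‖c‖ = 1) (hc' : ‖c'‖ = 1) {z w : disc}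
    (h : c • (polyWeight p z : ℂ) • evalDual (polyWeight p) z =
      c' • (polyWeight p w : ℂ) • evalDual (polyWeight p) w) : c = c' ∧ z = w := by
  have h₁ := one_sub_rpow_le_norm_sub (zero_le_one.trans hp) hc hc' z w
  rw [h, sub_self, norm_zero] at h₁
  have h₂ := rpow_one_sub_norm_mobius_sq_le hp z w
  have h₃ : ‖mobius z w‖ = 0 := by
    refine pow_eq_zero_iff (two_ne_zero) |>.1 (le_antisymm ?_ (sq_nonneg _))
    linarith
  have h₄ : z = w := by
    rw [norm_eq_zero, mobius, div_eq_zero_iff] at h₃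
    rcases h₃ with h₃ | h₃
    · exact Subtype.ext (sub_eq_zero.1 h₃).symm
    · exact absurd h₃ (one_sub_conj_mul_ne_zero (norm_coe_lt_one z) (norm_coe_lt_one w))
  subst h₄
  have h₅ := congrArg (fun φ => φ (peak (zero_le_one.trans hp) z)) h
  simp only [smul_weight_evalDual_peak] at h₅
  exact ⟨h₅, rfl⟩

/-- Pseudo-hyperbolic balls around `z` are relatively compact in the disc. -/
theorem exists_isCompact_mem_of_le_rpow (hp : 1 ≤ p) (z : disc) :
    ∃ K : Set disc, IsCompact K ∧ ∀ w : disc, 1 / 2 ≤ (1 - ‖mobius z w‖ ^ 2) ^ p → w ∈ K := by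
  have hz := norm_coe_lt_one z
  -- From 1/2 ≤ (1 - |z|²)(1 - |w|²)/|1 - z̄w|² and |1 - z̄w| ≥ 1 - |z| one gets 1 - |w|² ≥ r.
  set r : ℝ := (1 - ‖(z : ℂ)‖) ^ 2 / 2 with hr
  have hr0 : 0 < r := by
    have : 0 < 1 - ‖(z : ℂ)‖ := by linarith
    positivity
  refine ⟨{w : disc | ‖(w : ℂ)‖ ^ 2 ≤ 1 - r}, ?_, fun w hw => ?_⟩
  · have : ((fun w : disc => (w : ℂ)) '' {w : disc | ‖(w : ℂ)‖ ^ 2 ≤ 1 - r} : Set ℂ) =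
        closedBall 0 1 ∩ {w : ℂ | ‖w‖ ^ 2 ≤ 1 - r} := by
      ext w
      constructor
      · rintro ⟨w, hw, rfl⟩
        exact ⟨mem_closedBall_zero_iff.2 (norm_coe_lt_one w).le, hw⟩
      · rintro ⟨-, hw⟩
        have hw' : ‖w‖ ^ 2 ≤ 1 - r := hw
        exact ⟨⟨w, mem_ball_zero_iff.2 (by nlinarith [norm_nonneg w])⟩, hw, rfl⟩
    have hc : IsCompact (closedBall (0 : ℂ) 1 ∩ {w : ℂ | ‖w‖ ^ 2 ≤ 1 - r}) :=
      (isCompact_closedBall 0 1).inter_right (isClosed_le (by fun_prop) continuous_const)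
    rw [← this] at hc
    exact Topology.IsInducing.subtypeVal.isCompact_iff.2 hc
  · have hw1 := norm_coe_lt_one w
    have h₁ := hw.trans (rpow_one_sub_norm_mobius_sq_le hp z w)
    have hB := norm_pos_iff.2 (one_sub_conj_mul_ne_zero hz hw1)
    rw [one_sub_norm_mobius_sq hz hw1, le_div_iff₀ (by positivity)] at h₁
    have h₂ : 1 - ‖(z : ℂ)‖ ≤ ‖1 - (starRingEnd ℂ) (z : ℂ) * w‖ := by
      have h₃ := norm_sub_norm_le (1 : ℂ) ((starRingEnd ℂ) (z : ℂ) * w)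
      rw [norm_one, norm_mul, RCLike.norm_conj] at h₃
      nlinarith [norm_nonneg (z : ℂ), norm_nonneg (w : ℂ)]
    have h₃ : (1 - ‖(z : ℂ)‖) ^ 2 ≤ ‖1 - (starRingEnd ℂ) (z : ℂ) * w‖ ^ 2 :=
      pow_le_pow_left₀ (by linarith) h₂ 2
    have h₄ : (1 - ‖(z : ℂ)‖ ^ 2) * (1 - ‖(w : ℂ)‖ ^ 2) ≤ 1 * (1 - ‖(w : ℂ)‖ ^ 2) :=
      mul_le_mul_of_nonneg_right (by linarith [sq_nonneg ‖(z : ℂ)‖]) (one_sub_pos w).le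
    change ‖(w : ℂ)‖ ^ 2 ≤ 1 - r
    linarith

theorem mem_circleAtoms_iff {x : GInf (polyWeight p)} : x ∈ circleAtoms (polyWeight p) ↔
    ∃ c : ℂ, ‖c‖ = 1 ∧ ∃ z : disc, x = c • (polyWeight p z : ℂ) • delta (polyWeight p) z := by
  constructor
  · rintro ⟨c, hc, _, ⟨z, rfl⟩, rfl⟩
    exact ⟨c, hc, z, rfl⟩
  · rintro ⟨c, hc, z, rfl⟩
    exact ⟨c, hc, _, ⟨z, rfl⟩, rfl⟩

theorem coe_smul_weight_delta (c : ℂ) (z : disc) :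
    ((c • (polyWeight p z : ℂ) • delta (polyWeight p) z : GInf (polyWeight p)) :
      StrongDual ℂ (HInf (polyWeight p) ℂ)) =
      c • (polyWeight p z : ℂ) • evalDual (polyWeight p) z := rfl

theorem isClosed_circleAtoms (hp : 1 ≤ p) : IsClosed (circleAtoms (polyWeight p)) := by
  refine isClosed_of_closure_subset fun x hx => ?_
  obtain ⟨u, hu, hux⟩ := mem_closure_iff_seq_limit.1 hx
  choose c hc z hz using fun n => mem_circleAtoms_iff.1 (hu n)
  -- Atoms within 1/2 of the `N`-th one have base points in a fixed compact set, so the parameters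
  -- (c, z) subconverge inside 𝕋 × 𝔻.
  obtain ⟨N, hN⟩ := Metric.cauchySeq_iff'.1 hux.cauchySeq (1 / 2) (by norm_num)
  obtain ⟨K, hK, hKz⟩ := exists_isCompact_mem_of_le_rpow hp (z N)
  have hmem : ∀ n, (c (n + N), z (n + N)) ∈ sphere (0 : ℂ) 1 ×ˢ K := fun n => by
    refine ⟨mem_sphere_zero_iff_norm.2 (hc _), hKz _ ?_⟩
    have h₁ : ‖u N - u (n + N)‖ < 1 / 2 := by
      refine (norm_sub_rev (u N) (u (n + N))).trans_lt ?_
      exact (dist_eq_norm (u (n + N)) (u N)).symm.trans_lt (hN (n + N) (Nat.le_add_left _ _))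
    rw [hz N, hz (n + N)] at h₁
    have h₂ := (one_sub_rpow_le_norm_sub (zero_le_one.trans hp) (hc N) (hc (n + N)) (z N)
      (z (n + N))).trans_lt h₁
    linarith
  obtain ⟨⟨c₀, z₀⟩, ⟨hc₀, -⟩, k, hk, hlim⟩ :=
    ((isCompact_sphere (0 : ℂ) 1).prod hK).tendsto_subseq hmem
  -- It suffices to identify the norm limit weakly: for each `f` the pairing is continuous in (c,
  -- z).
  refine mem_circleAtoms_iff.2 ⟨c₀, mem_sphere_zero_iff_norm.1 hc₀, z₀, Subtype.ext
    (ContinuousLinearMap.ext fun f => ?_)⟩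
  have h₁ : Filter.Tendsto (fun n => evalMap f (u (k n + N))) Filter.atTop
      (nhds (evalMap f x)) :=
    ((evalMap f).continuous.tendsto x).comp
      (hux.comp ((Filter.tendsto_add_atTop_nat N).comp hk.tendsto_atTop))
  have hcont : Continuous fun q : ℂ × disc => q.1 * ((polyWeight p q.2 : ℂ) * f q.2) :=
    continuous_fst.mul ((Complex.continuous_ofReal.comp
      ((polyWeight p).continuous_toFun.comp continuous_snd)).mul
        (f.continuous.comp continuous_snd))
  have h₂ := (hcont.tendsto (c₀, z₀)).comp hlim
  refine tendsto_nhds_unique h₁ (h₂.congr fun n => ?_)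
  rw [hz (k n + N)]
  rfl

end Atoms

/-! ### Uniform strong exposition. -/

section Exposed

theorem UniformlyStronglyExposedBy.of_norm_sub_le {X : Type*} [NormedAddCommGroup X]
    [NormedSpace ℂ X] {S : Set X} {Φ : X → StrongDual ℂ X} (hS : ∀ x ∈ S, ‖x‖ = 1)
    (hΦ : ∀ x ∈ S, ∀ y, ‖Φ x y‖ ≤ ‖y‖) (hΦS : ∀ x ∈ S, Φ x x = 1)
    (h : ∀ ε : ℝ, 0 < ε → ∃ δ : ℝ, 0 < δ ∧ δ < 1 ∧
      ∀ x ∈ S, ∀ y, ‖y‖ ≤ 1 → (Φ x y).re > 1 - δ → ‖y - x‖ ≤ ε) :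
    UniformlyStronglyExposedBy S Φ := by
  refine ⟨fun x hx => mem_sphere_zero_iff_norm.2 (hS x hx), fun x hx =>
    ⟨norm_eq_one_of_apply_eq_one (hΦ x hx) (hS x hx).le (hΦS x hx), hΦS x hx⟩, fun ε hε _ => ?_⟩
  -- Radius ε/4 gives diameter at most ε/2, leaving room for the strict inequality.
  obtain ⟨δ, hδ, hδ1, hδε⟩ := h (ε / 4) (by positivity)
  refine ⟨δ, hδ, hδ1, fun x hx => ?_⟩
  have key : ∀ y ∈ slice (Φ x) δ, dist y x ≤ ε / 4 := fun y hy => by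
    rw [dist_eq_norm]
    exact hδε x hx y hy.1 hy.2
  have hdiam : diam (slice (Φ x) δ) ≤ ε / 2 := diam_le_of_forall_dist_le (by positivity)
    fun y hy y' hy' => (dist_triangle_right y y' x).trans
      ((add_le_add (key y hy) (key y' hy')).trans_eq (by ring))
  linarith

variable {p : ℝ}

open Classical in
/-- The functional `Φ_x` exposing `x = c v_p(z) δ_z`, extended by zero. -/
noncomputable def exposingFunctional (hp : 0 ≤ p) (x : GInf (polyWeight p)) :
    StrongDual ℂ (GInf (polyWeight p)) :=
  if h : ∃ q : ℂ × disc, ‖q.1‖ = 1 ∧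
      x = q.1 • (polyWeight p q.2 : ℂ) • delta (polyWeight p) q.2 then
    evalMap ((starRingEnd ℂ) h.choose.1 • peak hp h.choose.2)
  else 0

/-- An atom determines its parameters (`atom_injective`), so the choice made in the definition is
harmless. -/
theorem exposingFunctional_apply (hp : 1 ≤ p) {c : ℂ} (hc : ‖c‖ = 1) (z : disc) :
    exposingFunctional (zero_le_one.trans hp)
      (c • (polyWeight p z : ℂ) • delta (polyWeight p) z) =
      evalMap ((starRingEnd ℂ) c • peak (zero_le_one.trans hp) z) := by
  have h : ∃ q : ℂ × disc, ‖q.1‖ = 1 ∧ c • (polyWeight p z : ℂ) • delta (polyWeight p) z =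
      q.1 • (polyWeight p q.2 : ℂ) • delta (polyWeight p) q.2 := ⟨(c, z), hc, rfl⟩
  rw [exposingFunctional, dif_pos h]
  obtain ⟨h₁, h₂⟩ := atom_injective hp hc h.choose_spec.1
    (congrArg Subtype.val h.choose_spec.2)
  rw [← h₁, ← h₂]

theorem norm_atom (hp : 1 ≤ p) {c : ℂ} (hc : ‖c‖ = 1) (z : disc) :
    ‖c • (polyWeight p z : ℂ) • evalDual (polyWeight p) z‖ = 1 := by
  refine le_antisymm (norm_smul_weight_evalDual_le hc z) ?_
  have h := ((c • (polyWeight p z : ℂ) • evalDual (polyWeight p) z).le_opNorm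
    (peak (zero_le_one.trans hp) z)).trans (mul_le_of_le_one_right (norm_nonneg _)
      (norm_peak_le _ z))
  rwa [smul_weight_evalDual_peak, hc] at h

theorem evalMap_conj_smul_peak (hp : 0 ≤ p) (c : ℂ) (z : disc) (φ : GInf (polyWeight p)) :
    evalMap ((starRingEnd ℂ) c • peak hp z) φ =
      (starRingEnd ℂ) c * (φ : StrongDual ℂ (HInf (polyWeight p) ℂ)) (peak hp z) := by
  rw [evalMap_apply, map_smul, smul_eq_mul]

theorem uniformlyStronglyExposedBy_circleAtoms (hp : 1 ≤ p) :
    UniformlyStronglyExposedBy (circleAtoms (polyWeight p))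
      (exposingFunctional (zero_le_one.trans hp)) := by
  refine .of_norm_sub_le (fun x hx => ?_) (fun x hx φ => ?_) (fun x hx => ?_) fun ε hε => ?_
  · obtain ⟨c, hc, z, rfl⟩ := mem_circleAtoms_iff.1 hx
    exact norm_atom hp hc z
  · obtain ⟨c, hc, z, rfl⟩ := mem_circleAtoms_iff.1 hx
    rw [exposingFunctional_apply hp hc]
    refine (norm_evalMap_apply_le _ φ).trans (mul_le_of_le_one_left (norm_nonneg φ) ?_)
    refine (norm_smul _ (peak (zero_le_one.trans hp) z)).trans_le ?_
    rw [RCLike.norm_conj, hc, one_mul]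
    exact norm_peak_le _ z
  · obtain ⟨c, hc, z, rfl⟩ := mem_circleAtoms_iff.1 hx
    rw [exposingFunctional_apply hp hc, evalMap_conj_smul_peak, coe_smul_weight_delta,
      smul_weight_evalDual_peak, conj_mul_self_of_norm_eq_one hc]
  · obtain ⟨δ, hδ, hδ1, h⟩ := exists_norm_sub_atom_le hp hε
    refine ⟨δ, hδ, hδ1, fun x hx φ hφ hφx => ?_⟩
    obtain ⟨c, hc, z, rfl⟩ := mem_circleAtoms_iff.1 hx
    rw [exposingFunctional_apply hp hc, evalMap_conj_smul_peak] at hφx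
    exact h c hc z φ hφ hφx

end Exposed

/-! ### The Bishop–Phelps–Bollobás property. -/

section BishopPhelpsBollobas

variable {E : Type*} [NormedAddCommGroup E] [NormedSpace ℂ E]
variable {F : Type*} [NormedAddCommGroup F] [NormedSpace ℂ F]

/-- The mapping `w ↦ h(w) y`. -/
def HInf.smulRight {U : Opens E} {v : Weight U} (h : HInf v ℂ) (y : F) : HInf v F :=
  ⟨fun w => h w • y, by
    obtain ⟨g, hg, hgh⟩ := h.2.1
    refine ⟨⟨fun w => g w • y, hg.smul_const y, fun w => congrArg (· • y) (hgh w)⟩, ‖h‖ * ‖y‖, ?_⟩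
    rintro _ ⟨w, rfl⟩
    change v w * ‖h w • y‖ ≤ _
    rw [norm_smul, ← mul_assoc]
    exact mul_le_mul_of_nonneg_right (h.le_norm w) (norm_nonneg y)⟩

theorem HInf.smulRight_apply {U : Opens E} {v : Weight U} (h : HInf v ℂ) (y : F) (w : U) :
    h.smulRight y w = h w • y := rfl

theorem hasBPB_polyWeight {p : ℝ} (hp : 1 ≤ p) : HasBPB (polyWeight p) F := by
  intro ε hε hε1
  have hp0 : 0 ≤ p := zero_le_one.trans hp
  obtain ⟨δ, hδ, hδ1, hslice⟩ := exists_norm_sub_atom_le hp (ε := ε / 2) (by positivity)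
  -- `s` is the size of the perturbation; η is smaller by a factor of order δ, so that the gain at z
  -- outweighs the deficit 1 - Y < η.
  set s : ℝ := ε / 8 with hs
  have hs0 : 0 < s := by positivity
  set η : ℝ := s * (δ / 4) with hη
  have hη0 : 0 < η := by positivity
  have hηs : η ≤ s / 4 := by nlinarith
  refine ⟨η, hη0, by linarith, fun f hf c hc z hfz => ?_⟩
  have hvz := (polyWeight p).pos z
  have hfz1 : polyWeight p z * ‖f z‖ ≤ 1 := hf ▸ f.le_norm z
  set Y : ℝ := polyWeight p z * ‖f z‖ with hY
  set y : F := (polyWeight p z : ℂ) • f z with hy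
  have hyY : ‖y‖ = Y := by
    rw [hy, norm_smul, Complex.norm_real, Real.norm_of_nonneg hvz.le]
  set k : HInf (polyWeight p) F := (s : ℂ) • (peak hp0 z).smulRight y with hk
  have hkw : ∀ w, polyWeight p w * ‖k w‖ = s * Y * (1 - ‖mobius z w‖ ^ 2) ^ p := fun w => by
    rw [hk, HInf.smul_apply, HInf.smulRight_apply, norm_smul, norm_smul, hyY, Complex.norm_real,
      Real.norm_of_nonneg hs0.le, ← weight_mul_norm_peak hp0]
    ring
  set g : HInf (polyWeight p) F := f + k with hg
  set u : disc → ℝ := fun w => polyWeight p w * ‖g w‖ with hu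
  have hgw : ∀ w, u w ≤ 1 + s * Y * (1 - ‖mobius z w‖ ^ 2) ^ p := fun w => by
    have h₁ := mul_le_mul_of_nonneg_left (norm_add_le (f w) (k w)) ((polyWeight p).pos w).le
    have h₂ := hf ▸ f.le_norm w
    rw [mul_add, hkw] at h₁
    exact h₁.trans (add_le_add_left h₂ _)
  have hgz : u z = (1 + s) * Y := by
    have h₁ : g z = ((1 + s : ℝ) : ℂ) • f z := by
      rw [hg, HInf.add_apply, hk, HInf.smul_apply, HInf.smulRight_apply, hy, smul_smul (peak _ _ _),
        mul_comm (peak hp0 z z), weight_mul_peak_self, one_smul]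
      push_cast
      rw [add_smul, one_smul]
    simp only [hu]
    rw [h₁, norm_smul, Complex.norm_real, Real.norm_of_nonneg (by positivity)]
    ring
  have hY2 : 1 / 2 ≤ Y := by linarith
  -- With q = (1 - ρ²)^p, the inequality (1 + s)Y ≤ 1 + sYq gives sY(1 - q) ≤ 1 - Y < sδ/4, and Y ≥
  -- 1/2. As δ < 1, such `w` lie in the compact set `K` below, so `u` attains its supremum.
  have hlarge : ∀ w, u z ≤ u w → 1 - δ / 2 ≤ (1 - ‖mobius z w‖ ^ 2) ^ p := fun w hw => by
    have h₁ := hw.trans (hgw w)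
    rw [hgz] at h₁
    have h₂ := one_sub_norm_mobius_sq_rpow_le_one hp0 z w
    have h₃ : s * Y * (1 - (1 - ‖mobius z w‖ ^ 2) ^ p) ≤ s * (δ / 4) := by linarith
    have h₄ : Y * (1 - (1 - ‖mobius z w‖ ^ 2) ^ p) ≤ δ / 4 := by
      rw [mul_assoc] at h₃
      exact le_of_mul_le_mul_left h₃ hs0
    nlinarith
  obtain ⟨K, hK, hKz⟩ := exists_isCompact_mem_of_le_rpow hp z
  have hzK : z ∈ K := hKz z (by linarith [hlarge z le_rfl])
  have hucont : Continuous u :=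
    (polyWeight p).continuous_toFun.mul (continuous_norm.comp g.continuous)
  obtain ⟨z₀, -, hz₀⟩ := hK.exists_isMaxOn ⟨z, hzK⟩ hucont.continuousOn
  have hz₀z : u z ≤ u z₀ := hz₀ hzK
  have hmax : ∀ w, u w ≤ u z₀ := fun w => by
    by_cases hw : w ∈ K
    · exact hz₀ hw
    · refine le_trans (le_of_not_ge fun h => hw (hKz w ?_)) hz₀z
      linarith [hlarge w h]
  set M : ℝ := u z₀ with hM
  have hM0 : 0 < M := by
    rw [hgz] at hz₀z
    nlinarith
  have hgM : ‖g‖ = M := le_antisymm (HInf.norm_le hM0.le hmax) (g.le_norm z₀)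
  have hkn : ‖k‖ ≤ s := HInf.norm_le hs0.le fun w => by
    rw [hkw, mul_assoc]
    exact mul_le_of_le_one_right hs0.le
      (mul_le_one₀ hfz1 (Real.rpow_nonneg (one_sub_norm_mobius_sq_pos z w).le _)
        (one_sub_norm_mobius_sq_rpow_le_one hp0 z w))
  have hMs : |M - 1| ≤ s := by
    rw [abs_le]
    constructor
    · rw [hgz] at hz₀z
      nlinarith
    · have : ‖g‖ ≤ ‖f‖ + ‖k‖ := norm_add_le f k
      rw [hgM, hf] at this
      linarith
  have hMinv : ‖((M⁻¹ : ℝ) : ℂ)‖ = M⁻¹ := by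
    rw [Complex.norm_real, Real.norm_of_nonneg (inv_pos.2 hM0).le]
  -- The phase `d` makes the value of the new atom at f_z equal to c(1 - ρ²)^p, with ρ taken at
  -- `z₀`; by `hlarge` this puts it in the slice of the atom at z.
  obtain ⟨d, hd, hdb⟩ := RCLike.exists_norm_eq_mul_self ((polyWeight p z₀ : ℂ) * peak hp0 z z₀)
  have hcd : ‖c * d‖ = 1 := by rw [norm_mul, hc, hd, one_mul]
  refine ⟨((M⁻¹ : ℝ) : ℂ) • g, ?_, c * d, hcd, z₀, ?_, ?_, ?_⟩
  · refine (norm_smul _ g).trans ?_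
    rw [hMinv, hgM, inv_mul_cancel₀ hM0.ne']
  · rw [HInf.smul_apply, norm_smul, hMinv]
    have : polyWeight p z₀ * (M⁻¹ * ‖g z₀‖) = M⁻¹ * u z₀ := by
      simp only [hu]
      ring
    rw [this, ← hM, inv_mul_cancel₀ hM0.ne']
  -- Normalising costs |M - 1| ≤ s and the perturbation costs at most s, in total 2s = ε/4.
  · have h₁ : f - ((M⁻¹ : ℝ) : ℂ) • g = ((1 - M⁻¹ : ℝ) : ℂ) • g - k := by
      rw [Complex.ofReal_sub, Complex.ofReal_one, sub_smul, one_smul, hg]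
      abel
    rw [h₁]
    have h₂ : ‖((1 - M⁻¹ : ℝ) : ℂ) • g‖ ≤ s := by
      refine (norm_smul _ g).trans_le ?_
      rw [Complex.norm_real, Real.norm_eq_abs, hgM]
      calc |1 - M⁻¹| * M = |(1 - M⁻¹) * M| := by rw [abs_mul, abs_of_pos hM0]
        _ = |M - 1| := by rw [sub_mul, one_mul, inv_mul_cancel₀ hM0.ne']
        _ ≤ s := hMs
    refine (norm_sub_le _ _).trans_lt ?_
    linarith
  · have h₁ := hslice c hc z ((c * d) • (polyWeight p z₀ : ℂ) • evalDual (polyWeight p) z₀)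
      (norm_smul_weight_evalDual_le hcd z₀) (by
        rw [smul_apply, smul_apply, evalDual_apply, smul_eq_mul, smul_eq_mul, mul_assoc c, ← hdb,
          ← mul_assoc, conj_mul_self_of_norm_eq_one hc, one_mul, norm_mul, Complex.norm_real,
          Real.norm_of_nonneg ((polyWeight p).pos z₀).le, weight_mul_norm_peak]
        have := hlarge z₀ hz₀z
        change 1 - δ < (1 - ‖mobius z z₀‖ ^ 2) ^ p
        linarith)
    rw [norm_sub_rev] at h₁
    exact lt_of_le_of_lt h₁ (by linarith)

end BishopPhelpsBollobas

end WHol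

theorem theorem1p6 (p : ℝ) (hp : 1 ≤ p) :
    (∀ (F : Type*) [NormedAddCommGroup F] [NormedSpace ℂ F] [CompleteSpace F],
      WHol.HasBPB (WHol.polyWeight p) F) ∧
    IsClosed (WHol.circleAtoms (WHol.polyWeight p)) ∧
    ∃ f : WHol.disc → WHol.HInf (WHol.polyWeight p) ℂ,
      (∀ z w : WHol.disc, f z w = WHol.mobiusDerivPow p z w) ∧
      ∃ Φ : WHol.GInf (WHol.polyWeight p) → StrongDual ℂ (WHol.GInf (WHol.polyWeight p)),
        WHol.UniformlyStronglyExposedBy (WHol.circleAtoms (WHol.polyWeight p)) Φ ∧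
        ∀ c : ℂ, ‖c‖ = 1 → ∀ z : WHol.disc,
          Φ (c • (WHol.polyWeight p z : ℂ) • WHol.delta (WHol.polyWeight p) z) =
            WHol.evalMap ((starRingEnd ℂ) c • f z) :=
  ⟨fun _ _ _ _ => WHol.hasBPB_polyWeight hp, WHol.isClosed_circleAtoms hp,
    WHol.peak (zero_le_one.trans hp), fun _ _ => rfl,
    WHol.exposingFunctional (zero_le_one.trans hp),
    WHol.uniformlyStronglyExposedBy_circleAtoms hp,
    fun _ hc z => WHol.exposingFunctional_apply hp hc z⟩
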